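/- Let $p,q,a,c$ be nonzero complex numbers with $|p|<1$ and let $n\ge 0$ be an integer. For $x\neq 0$ put $$\theta(x;p)=\prod_{j\ge 0}(1-p^jx)(1-p^{j+1}/x),\qquad (x;q,p)_k=\prod_{j=0}^{k-1}\theta(xq^j;p),\qquad (x_1,\dots,x_m;q,p)_k=\prod_{i=1}^m(x_i;q,p)_k .$$ Let $$W_c^n=\operatorname{span}_{\mathbb C}\left\{\frac{g_k(z)}{(cz,c/z;q,p)_k}\;:\;0\le k\le n\right\},$$ where $g_k$ runs over all functions holomorphic on $\mathbb C\setminus\{0\}$ with $g_k(z)=g_k(1/z)$ and $g_k(pz)=p^{-k}z^{-2k}g_k(z)$. **Theorem.** If $f\in W_c^n$, then $$\frac{(a^2q,q,cz,c/z;q,p)_n}{(ac,c/a,aqz,aq/z;q,p)_n}\,f(z)=\sum_{k=0}^n q^k\,\frac{\theta(a^2q^{2k};p)}{\theta(a^2;p)}\,\frac{(q^{-n},a^2,aq/c,acq^n,az,a/z;q,p)_k}{(q,a^2q^{n+1},ac,aq^{1-n}/c,aqz,aq/z;q,p)_k}\,f(aq^k)$$ for all nonzero complex $z$, provided that the functions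 in $W_c^n$ are defined at the points of evaluation, i.e. $(cw,c/w;q,p)_n\neq0$ for $w=z$ and for $w=aq^k$, $0\le k\le n$, and that no denominator in the formula vanishes, i.e. $\theta(a^2;p)\neq0$, $(ac,c/a,q,a^2q^{n+1};q,p)_n\neq 0$ and $(aqz,aq/z;q,p)_n\neq0$. -/

import Mathlib

/-- The modified Jacobi theta function with argument `x` and nome `p`:
`θ(x;p) = ∏_{j ≥ 0} (1 - p^j x) (1 - p^(j+1) / x)`, meaningful for `x ≠ 0` and `|p| < 1`. -/
noncomputable def ellTheta (x p : ℂ) : ℂ :=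
  ∏' j : ℕ, ((1 - p ^ j * x) * (1 - p ^ (j + 1) / x))

/-- The theta shifted factorial `(a;q,p)_n = ∏_{k=0}^{n-1} θ(a q^k;p)`, for `n ≥ 0`. -/
noncomputable def thetaPoch (a q p : ℂ) (n : ℕ) : ℂ :=
  ∏ k ∈ Finset.range n, ellTheta (a * q ^ k) p

/-- The compact notation `(a₁, …, a_m;q,p)_n = ∏_i (a_i;q,p)_n`. -/
noncomputable def thetaPochs (as : List ℂ) (q p : ℂ) (n : ℕ) : ℂ :=
  (as.map fun a => thetaPoch a q p n).prod

/-- `g` is an even theta function of order `2k` and zero characteristic with nome `p`: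
holomorphic on `ℂ \ {0}`, invariant under `z ↦ 1/z`, and `g(pz) = g(z) / (p^k z^(2k))`. The value
`g 0` carries no information. -/
structure IsEvenTheta (p : ℂ) (k : ℕ) (g : ℂ → ℂ) : Prop where
  holo : DifferentiableOn ℂ g {0}ᶜ
  symm : ∀ z : ℂ, z ≠ 0 → g z = g (1 / z)
  quasi : ∀ z : ℂ, z ≠ 0 → g (p * z) = 1 / (p ^ k * z ^ (2 * k)) * g z

/-- The space `W_c^n`: the complex span of the functions `g_k(z) / (cz, c/z;q,p)_k` with
`0 ≤ k ≤ n`, where `g_k` runs over all even theta functions of order `2k`. Its members are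
meromorphic on `ℂ \ {0}`; their values are meaningful at those `z ≠ 0` for which
`(cz, c/z;q,p)_n ≠ 0`. -/
noncomputable def ellW (c q p : ℂ) (n : ℕ) : Submodule ℂ (ℂ → ℂ) :=
  Submodule.span ℂ {f | ∃ k : ℕ, k ≤ n ∧ ∃ g : ℂ → ℂ, IsEvenTheta p k g ∧
    f = fun z => g z / thetaPochs [c * z, c / z] q p k}

/-!
# The expansion formula in `W_c^n` as Lagrange interpolation

Over the common denominator `(cz, c/z;q,p)_n`, a member `f` of `W_c^n` has as numerator an even
theta function `h` of order `2n` (`exists_evenTheta_of_mem_ellW`). Such an `h` is determined by its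
values at `n + 1` points in general position: if it vanishes there, then dividing by
`∏ θ(w_i z;p) θ(w_i/z;p)`, whose zeros are simple, gives an even theta function of order `-2`, and
that is bounded, hence constant by Liouville's theorem, hence zero
(`IsEvenTheta.eq_zero_of_vanish`). So `h` is given by Lagrange's formula
(`IsEvenTheta.eq_sum_interpolation`). For the nodes `w_k = a q^k` the Lagrange coefficients are
those of the expansion formula (`interpolation_coeff`), by the reflection `θ(1/x;p) = -θ(x;p)/x`
and the splitting of theta shifted factorials.

The hypotheses allow `θ(a²q^m;p) = 0` for some `1 ≤ m ≤ n`, and then the nodes are not in general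
position, as `a q^j` and `1/(a q^(m-j))` coincide up to a power of `p`. Both sides of the formula
are continuous in `a`, and the exceptional values of `a` are isolated
(`eventually_thetaPoch_sq_ne_zero`), so this case follows from the generic one
(`expansion_of_generic`).
-/

open Filter Topology

/-! ### The theta function: functional equations and zeros -/

/-- The infinite `p`-shifted factorial `(x;p)_∞ = ∏_{j ≥ 0} (1 - p^j x)`. -/
noncomputable def infPoch (x p : ℂ) : ℂ := ∏' j : ℕ, (1 - p ^ j * x)

theorem summable_norm_neg_pow_mul {p : ℂ} (hp : ‖p‖ < 1) (x : ℂ) :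
    Summable fun j : ℕ => ‖-(p ^ j * x)‖ := by
  simp only [norm_neg, norm_mul, norm_pow]
  exact (summable_geometric_of_lt_one (norm_nonneg _) hp).mul_right _

theorem multipliable_infPoch {p : ℂ} (hp : ‖p‖ < 1) (x : ℂ) :
    Multipliable fun j : ℕ => 1 - p ^ j * x := by
  simpa [sub_eq_add_neg] using multipliable_one_add_of_summable (summable_norm_neg_pow_mul hp x)

theorem infPoch_eq_mul {p : ℂ} (hp : ‖p‖ < 1) (x : ℂ) :
    infPoch x p = (1 - x) * infPoch (p * x) p := by
  have h := multipliable_infPoch hp (p * x)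
  rw [infPoch, tprod_eq_zero_mul' (f := fun j : ℕ => 1 - p ^ j * x)]
  · simp [infPoch, pow_succ, mul_assoc]
  · simpa [pow_succ, mul_assoc] using h

theorem infPoch_eq_zero {p x : ℂ} (hp : ‖p‖ < 1) (h : infPoch x p = 0) :
    ∃ j : ℕ, p ^ j * x = 1 := by
  by_contra! hne
  refine tprod_one_add_ne_zero_of_summable (f := fun j : ℕ => -(p ^ j * x)) (fun j hj => ?_)
    (summable_norm_neg_pow_mul hp x) (by simpa [infPoch, sub_eq_add_neg] using h)
  exact hne j (by linear_combination -hj)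

theorem differentiable_infPoch {p : ℂ} (hp : ‖p‖ < 1) :
    Differentiable ℂ fun x => infPoch x p := by
  intro x
  have hU : IsOpen (Metric.ball (0 : ℂ) (‖x‖ + 1)) := Metric.isOpen_ball
  have hprod := Summable.hasProdLocallyUniformlyOn_nat_one_add
    (f := fun (j : ℕ) (y : ℂ) => -(p ^ j * y)) hU
    (u := fun j => ‖p‖ ^ j * (‖x‖ + 1))
    ((summable_geometric_of_lt_one (norm_nonneg _) hp).mul_right _)
    (Eventually.of_forall fun j y hy => by
      rw [norm_neg, norm_mul, norm_pow]
      gcongr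
      simpa using (mem_ball_zero_iff.1 hy).le)
    (fun j => by fun_prop)
  have hd := (hasProdLocallyUniformlyOn_iff_tendstoLocallyUniformlyOn.1 hprod).differentiableOn
    (Eventually.of_forall fun s => DifferentiableOn.fun_finsetProd fun j _ => by fun_prop) hU
  have := (hd x (by simp)).differentiableAt (hU.mem_nhds (by simp))
  simpa [infPoch, sub_eq_add_neg] using this

theorem ellTheta_eq_infPoch_mul {p : ℂ} (hp : ‖p‖ < 1) (x : ℂ) :
    ellTheta x p = infPoch x p * infPoch (p / x) p := by
  rw [infPoch, infPoch, ← (multipliable_infPoch hp x).tprod_mul (multipliable_infPoch hp (p / x)),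
    ellTheta]
  congr! 4 with j
  ring

theorem ellTheta_mul_nome {p x : ℂ} (hp0 : p ≠ 0) (hp : ‖p‖ < 1) (hx : x ≠ 0) :
    ellTheta (p * x) p = -x⁻¹ * ellTheta x p := by
  rw [ellTheta_eq_infPoch_mul hp, ellTheta_eq_infPoch_mul hp, infPoch_eq_mul hp x,
    infPoch_eq_mul hp (p / (p * x))]
  have h1 : p / (p * x) = x⁻¹ := by field_simp
  rw [h1, ← div_eq_mul_inv]
  field_simp
  ring

theorem ellTheta_inv {p x : ℂ} (hp0 : p ≠ 0) (hp : ‖p‖ < 1) (hx : x ≠ 0) :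
    ellTheta x⁻¹ p = -x⁻¹ * ellTheta x p := by
  rw [← ellTheta_mul_nome hp0 hp hx, ellTheta_eq_infPoch_mul hp, ellTheta_eq_infPoch_mul hp]
  have h1 : p / (p * x) = x⁻¹ := by field_simp
  rw [div_inv_eq_mul, mul_comm, h1]

theorem ellTheta_one {p : ℂ} (hp : ‖p‖ < 1) : ellTheta 1 p = 0 := by
  rw [ellTheta_eq_infPoch_mul hp, infPoch_eq_mul hp]; simp

theorem ellTheta_eq_zero {p x : ℂ} (hp0 : p ≠ 0) (hp : ‖p‖ < 1) (hx : x ≠ 0)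
    (h : ellTheta x p = 0) : ∃ m : ℤ, x = p ^ m := by
  rw [ellTheta_eq_infPoch_mul hp, mul_eq_zero] at h
  rcases h with h | h <;> obtain ⟨j, hj⟩ := infPoch_eq_zero hp h
  · exact ⟨-j, by rw [zpow_neg, zpow_natCast]; exact eq_inv_of_mul_eq_one_right hj⟩
  · refine ⟨j + 1, ?_⟩
    field_simp at hj
    rw [zpow_add₀ hp0]
    simp [hj.symm, mul_comm]

/-- A property of `1` stable under multiplication and division by `p` holds at all zeros of
`θ(·;p)`. -/
theorem ellTheta_zero_induction {p : ℂ} (hp0 : p ≠ 0) (hp : ‖p‖ < 1) {P : ℂ → Prop}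
    (h1 : P 1) (hmul : ∀ x, x ≠ 0 → (P (p * x) ↔ P x)) {x : ℂ} (hx : x ≠ 0)
    (h : ellTheta x p = 0) : P x := by
  obtain ⟨m, rfl⟩ := ellTheta_eq_zero hp0 hp hx h
  induction m using Int.induction_on with
  | zero => simpa using h1
  | succ i ih =>
    rw [zpow_add_one₀ hp0, mul_comm, hmul _ (zpow_ne_zero _ hp0)]
    refine ih (zpow_ne_zero _ hp0) ?_
    rw [zpow_add_one₀ hp0, mul_comm, ellTheta_mul_nome hp0 hp (zpow_ne_zero _ hp0)] at h
    simpa [hp0] using h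
  | pred i ih =>
    have hne : p ^ (-(i : ℤ) - 1) ≠ 0 := zpow_ne_zero _ hp0
    have e : p * p ^ (-(i : ℤ) - 1) = p ^ (-(i : ℤ)) := by
      rw [zpow_sub_one₀ hp0]; field_simp
    rw [← hmul _ hne, e]
    refine ih (zpow_ne_zero _ hp0) ?_
    rw [← e, ellTheta_mul_nome hp0 hp hne, h, mul_zero]

theorem ellTheta_mul_eq_zero_iff {p x y : ℂ} (hp0 : p ≠ 0) (hp : ‖p‖ < 1) (hx : x ≠ 0)
    (hy : y ≠ 0) (h : ellTheta x p = 0) : ellTheta (x * y) p = 0 ↔ ellTheta y p = 0 := by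
  refine ellTheta_zero_induction hp0 hp (P := fun x => ellTheta (x * y) p = 0 ↔ ellTheta y p = 0)
    (by simp) (fun x hx => ?_) hx h
  rw [mul_assoc, ellTheta_mul_nome hp0 hp (mul_ne_zero hx hy)]
  simp [hx, hy]

theorem differentiableAt_ellTheta {p x : ℂ} (hp : ‖p‖ < 1) (hx : x ≠ 0) :
    DifferentiableAt ℂ (fun x => ellTheta x p) x := by
  simp only [ellTheta_eq_infPoch_mul hp]
  refine (differentiable_infPoch hp x).mul ?_
  exact (differentiable_infPoch hp (p / x)).comp (f := fun x => p / x) x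
    (by fun_prop (disch := exact hx))

/-- The zeros of `θ(·;p)` are simple: at `1` the factor `1 - x` splits off, and the functional
equation transports the derivative to the other zeros. -/
theorem deriv_ellTheta_ne_zero {p x : ℂ} (hp0 : p ≠ 0) (hp : ‖p‖ < 1) (hx : x ≠ 0)
    (h : ellTheta x p = 0) : deriv (fun x => ellTheta x p) x ≠ 0 := by
  suffices ellTheta x p = 0 ∧ deriv (fun x => ellTheta x p) x ≠ 0 from this.2
  refine ellTheta_zero_induction hp0 hp
    (P := fun x => ellTheta x p = 0 ∧ deriv (fun x => ellTheta x p) x ≠ 0)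
    ⟨ellTheta_one hp, ?_⟩ (fun x hx => ?_) hx h
  · have hne : infPoch p p ≠ 0 := by
      intro h0
      obtain ⟨j, hj⟩ := infPoch_eq_zero hp h0
      have : ‖p ^ (j + 1)‖ < 1 := by
        rw [norm_pow]; exact pow_lt_one₀ (norm_nonneg _) hp (by simp)
      rw [pow_succ, hj] at this
      simp at this
    have hd : HasDerivAt (fun x => (1 - x) * (infPoch (p * x) p * infPoch (p / x) p))
        ((-1) * (infPoch (p * 1) p * infPoch (p / 1) p) + (1 - 1) *
          deriv (fun x => infPoch (p * x) p * infPoch (p / x) p) 1) (1 : ℂ) := by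
      refine ((hasDerivAt_id (1 : ℂ)).const_sub 1).mul (DifferentiableAt.hasDerivAt ?_)
      refine ((differentiable_infPoch hp (p * 1)).comp (f := fun x => p * x) (1 : ℂ)
        (by fun_prop)).mul ?_
      exact (differentiable_infPoch hp (p / 1)).comp (f := fun x => p / x) (1 : ℂ)
        (by fun_prop (disch := simp))
    have e : (fun x => ellTheta x p) =
        fun x => (1 - x) * (infPoch (p * x) p * infPoch (p / x) p) := by
      ext x
      rw [ellTheta_eq_infPoch_mul hp, infPoch_eq_mul hp x, mul_assoc]
    rw [e, hd.deriv]
    simpa using hne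
  · have h1 : ellTheta (p * x) p = 0 ↔ ellTheta x p = 0 := by
      rw [ellTheta_mul_nome hp0 hp hx]; simp [hx]
    rw [h1]
    refine and_congr_right fun h0 => not_congr ?_
    have hpx : p * x ≠ 0 := mul_ne_zero hp0 hx
    have hl : HasDerivAt (fun y => ellTheta (p * y) p)
        (p * deriv (fun x => ellTheta x p) (p * x)) x := by
      have := (differentiableAt_ellTheta hp hpx).hasDerivAt.comp x
        ((hasDerivAt_id x).const_mul p)
      simpa [Function.comp_def, mul_comm] using this
    have hr : HasDerivAt (fun y => -y⁻¹ * ellTheta y p)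
        (-(-(x ^ 2)⁻¹) * ellTheta x p + -x⁻¹ * deriv (fun x => ellTheta x p) x) x :=
      (hasDerivAt_inv hx).neg.mul (differentiableAt_ellTheta hp hx).hasDerivAt
    have heq : (fun y => ellTheta (p * y) p) =ᶠ[𝓝 x] fun y => -y⁻¹ * ellTheta y p := by
      filter_upwards [isOpen_ne.mem_nhds hx] with y hy using ellTheta_mul_nome hp0 hp hy
    have := (hl.congr_of_eventuallyEq heq.symm).unique hr
    rw [h0, mul_zero, zero_add] at this
    constructor
    · intro h; simpa [h, hx, eq_comm] using this
    · intro h; simpa [h, hp0] using this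

/-! ### Even theta functions and their interpolation -/

namespace IsEvenTheta

variable {p : ℂ} {k l : ℕ} {g h : ℂ → ℂ}

theorem const_mul (hg : IsEvenTheta p k g) (r : ℂ) : IsEvenTheta p k fun z => r * g z where
  holo := hg.holo.const_mul r
  symm z hz := by rw [hg.symm z hz]
  quasi z hz := by rw [hg.quasi z hz]; ring

theorem add (hg : IsEvenTheta p k g) (hh : IsEvenTheta p k h) :
    IsEvenTheta p k fun z => g z + h z where
  holo := hg.holo.add hh.holo
  symm z hz := by rw [hg.symm z hz, hh.symm z hz]
  quasi z hz := by rw [hg.quasi z hz, hh.quasi z hz]; ring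

theorem mul (hg : IsEvenTheta p k g) (hh : IsEvenTheta p l h) :
    IsEvenTheta p (k + l) fun z => g z * h z where
  holo := hg.holo.mul hh.holo
  symm z hz := by rw [hg.symm z hz, hh.symm z hz]
  quasi z hz := by
    rw [hg.quasi z hz, hh.quasi z hz, mul_add, pow_add, pow_add]
    simp only [one_div, mul_inv]
    ring

theorem zero : IsEvenTheta p k fun _ => 0 where
  holo := differentiableOn_const 0
  symm z hz := rfl
  quasi z hz := by simp

theorem one : IsEvenTheta p 0 fun _ => 1 where
  holo := differentiableOn_const 1
  symm z hz := rfl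
  quasi z hz := by simp

theorem sum {ι : Type*} {s : Finset ι} {G : ι → ℂ → ℂ}
    (hG : ∀ i ∈ s, IsEvenTheta p k (G i)) : IsEvenTheta p k fun z => ∑ i ∈ s, G i z := by
  classical
  induction s using Finset.induction_on with
  | empty => simpa using zero
  | insert i s hi ih =>
    simp only [Finset.sum_insert hi]
    exact (hG i (by simp)).add (ih fun j hj => hG j (by simp [hj]))

theorem prod {ι : Type*} {s : Finset ι} {G : ι → ℂ → ℂ}
    (hG : ∀ i ∈ s, IsEvenTheta p 1 (G i)) : IsEvenTheta p s.card fun z => ∏ i ∈ s, G i z := by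
  classical
  induction s using Finset.induction_on with
  | empty => simpa using one
  | insert i s hi ih =>
    simp only [Finset.prod_insert hi, Finset.card_insert_of_notMem hi]
    rw [add_comm]
    exact (hG i (by simp)).mul (ih fun j hj => hG j (by simp [hj]))

theorem differentiableAt (hg : IsEvenTheta p k g) {z : ℂ} (hz : z ≠ 0) :
    DifferentiableAt ℂ g z :=
  hg.holo.differentiableAt (isOpen_ne.mem_nhds hz)

/-- The zero set of an even theta function is invariant under the zeros of `θ(·;p)`, that is, the
powers of `p`. -/
theorem apply_mul_eq_zero (hp0 : p ≠ 0) (hp : ‖p‖ < 1) (hg : IsEvenTheta p k g) {w x : ℂ}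
    (hw : w ≠ 0) (hgw : g w = 0) (hx : x ≠ 0) (h : ellTheta x p = 0) : g (x * w) = 0 := by
  refine ellTheta_zero_induction hp0 hp (P := fun x => g (x * w) = 0) (by simpa)
    (fun x hx => ?_) hx h
  rw [mul_assoc, hg.quasi _ (mul_ne_zero hx hw)]
  simp [hp0, hx, hw]

end IsEvenTheta

/-- The product `θ(wz;p) θ(w/z;p)`, the basic even theta function of order `2`; it vanishes at
`z = w` and `z = 1/w`. -/
noncomputable def thetaPair (p w z : ℂ) : ℂ := ellTheta (w * z) p * ellTheta (w / z) p

section thetaPair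

variable {p : ℂ} (hp0 : p ≠ 0) (hp : ‖p‖ < 1)
include hp0 hp

theorem isEvenTheta_thetaPair {w : ℂ} (hw : w ≠ 0) : IsEvenTheta p 1 (thetaPair p w) where
  holo z hz := by
    have hz : z ≠ 0 := hz
    refine DifferentiableAt.differentiableWithinAt (DifferentiableAt.mul ?_ ?_)
    · exact (differentiableAt_ellTheta hp (mul_ne_zero hw hz)).comp (f := fun z => w * z) z
        (by fun_prop)
    · exact (differentiableAt_ellTheta hp (div_ne_zero hw hz)).comp (f := fun z => w / z) z
        (by fun_prop (disch := exact hz))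
  symm z hz := by
    unfold thetaPair
    rw [mul_comm]
    congr 2 <;> field_simp
  quasi z hz := by
    have h1 : ellTheta (w / z) p = -(w / (p * z))⁻¹ * ellTheta (w / (p * z)) p := by
      rw [← ellTheta_mul_nome hp0 hp (div_ne_zero hw (mul_ne_zero hp0 hz))]
      congr 1
      field_simp
    have h2 : ellTheta (w * (p * z)) p = -(w * z)⁻¹ * ellTheta (w * z) p := by
      rw [← ellTheta_mul_nome hp0 hp (mul_ne_zero hw hz)]
      congr 1
      ring
    unfold thetaPair
    rw [h1, h2]
    field_simp
    ring

/-- An even theta function that vanishes at `w` vanishes at all zeros of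
`z ↦ θ(wz;p) θ(w/z;p)`. -/
theorem IsEvenTheta.apply_eq_zero_of_thetaPair {w z : ℂ} {k : ℕ} {h : ℂ → ℂ}
    (hh : IsEvenTheta p k h) (hw : w ≠ 0) (hz : z ≠ 0) (h0 : h w = 0)
    (hzero : thetaPair p w z = 0) : h z = 0 := by
  rcases mul_eq_zero.1 hzero with h1 | h1
  · have h2 : h w⁻¹ = 0 := by rw [hh.symm _ (inv_ne_zero hw)]; simpa using h0
    have := hh.apply_mul_eq_zero hp0 hp (inv_ne_zero hw) h2 (mul_ne_zero hw hz) h1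
    rwa [mul_right_comm, mul_inv_cancel₀ hw, one_mul] at this
  · have h2 : h w⁻¹ = 0 := by rw [hh.symm _ (inv_ne_zero hw)]; simpa using h0
    have := hh.apply_mul_eq_zero hp0 hp (inv_ne_zero hw) h2 (div_ne_zero hw hz) h1
    rw [hh.symm _ hz]
    rwa [show w / z * w⁻¹ = 1 / z by field_simp] at this

omit hp0 in
theorem thetaPair_self {w : ℂ} (hw : w ≠ 0) : thetaPair p w w = 0 := by
  rw [thetaPair, div_self hw, ellTheta_one hp, mul_zero]

/-- If `θ(ww';p)` and `θ(w/w';p)` do not vanish, then the zeros of the two pairs are disjoint. -/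
theorem thetaPair_ne_zero_of_eq_zero {w w' z : ℂ} (hw : w ≠ 0) (hw' : w' ≠ 0) (hz : z ≠ 0)
    (h : thetaPair p w' w ≠ 0) (hzero : thetaPair p w z = 0) : thetaPair p w' z ≠ 0 := by
  intro h'
  -- the zeros of `θ(·;p)` form a group, and for a common zero `z` of the two pairs the product or
  -- quotient of the vanishing arguments is `w'w` or `w'/w`
  refine h ?_
  have e : ∀ {x y : ℂ}, x ≠ 0 → y ≠ 0 → ellTheta x p = 0 → ellTheta y p = 0 →
      ellTheta (x * y) p = 0 := fun hx hy h1 h2 =>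
    (ellTheta_mul_eq_zero_iff hp0 hp hx hy h1).2 h2
  have ei : ∀ {x : ℂ}, x ≠ 0 → ellTheta x p = 0 → ellTheta x⁻¹ p = 0 := fun hx h => by
    rw [ellTheta_inv hp0 hp hx, h, mul_zero]
  have a1 := mul_ne_zero hw hz
  have a2 := div_ne_zero hw hz
  have a3 := mul_ne_zero hw' hz
  have a4 := div_ne_zero hw' hz
  rw [thetaPair, mul_eq_zero]
  rcases mul_eq_zero.1 hzero with h1 | h1 <;> rcases mul_eq_zero.1 h' with h2 | h2
  · right; convert e a3 (inv_ne_zero a1) h2 (ei a1 h1) using 2; field_simp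
  · left; convert e a4 a1 h2 h1 using 2; field_simp
  · left; convert e a3 a2 h2 h1 using 2; field_simp
  · right; convert e a4 (inv_ne_zero a2) h2 (ei a2 h1) using 2; field_simp

theorem deriv_thetaPair_ne_zero {w z : ℂ} (hw : w ≠ 0) (hz : z ≠ 0)
    (h : ellTheta (w * w) p ≠ 0) (hzero : thetaPair p w z = 0) :
    deriv (thetaPair p w) z ≠ 0 := by
  have a1 := mul_ne_zero hw hz
  have a2 := div_ne_zero hw hz
  have d1 : HasDerivAt (fun z => ellTheta (w * z) p)
      (deriv (fun x => ellTheta x p) (w * z) * w) z := by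
    have := (differentiableAt_ellTheta hp a1).hasDerivAt.comp z ((hasDerivAt_id z).const_mul w)
    simpa [Function.comp_def] using this
  have d2 : HasDerivAt (fun z => ellTheta (w / z) p)
      (deriv (fun x => ellTheta x p) (w / z) * (w * -(z ^ 2)⁻¹)) z := by
    have := (differentiableAt_ellTheta hp a2).hasDerivAt.comp (h := fun z => w / z) z
      (by simpa [div_eq_mul_inv] using (hasDerivAt_inv hz).const_mul w)
    simpa [Function.comp_def] using this
  have hd := (d1.mul d2).deriv
  have e : deriv (thetaPair p w) z = _ := hd
  rw [e]
  have hprod : ellTheta (w * z) p = 0 → ellTheta (w / z) p ≠ 0 := fun h1 h2 => h <| by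
    have := (ellTheta_mul_eq_zero_iff hp0 hp a1 a2 h1).2 h2
    convert this using 2
    field_simp
  by_cases h1 : ellTheta (w * z) p = 0
  · rw [h1, zero_mul, add_zero]
    exact mul_ne_zero (mul_ne_zero (deriv_ellTheta_ne_zero hp0 hp a1 h1) hw) (hprod h1)
  · have h2 : ellTheta (w / z) p = 0 := (mul_eq_zero.1 hzero).resolve_left h1
    rw [h2, mul_zero, zero_add]
    exact mul_ne_zero h1 (mul_ne_zero (deriv_ellTheta_ne_zero hp0 hp a2 h2)
      (mul_ne_zero hw (neg_ne_zero.2 (inv_ne_zero (pow_ne_zero _ hz)))))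

end thetaPair

/-- A holomorphic function vanishing at the zeros of `u`, all of which are simple, is divisible
by `u`. -/
theorem exists_eq_mul_of_simple_zeros {U : Set ℂ} (hU : IsOpen U) {u h : ℂ → ℂ}
    (hu : DifferentiableOn ℂ u U) (hh : DifferentiableOn ℂ h U)
    (hsimple : ∀ z ∈ U, u z = 0 → deriv u z ≠ 0) (hzero : ∀ z ∈ U, u z = 0 → h z = 0) :
    ∃ g : ℂ → ℂ, DifferentiableOn ℂ g U ∧ ∀ z ∈ U, h z = u z * g z := by
  classical
  refine ⟨fun z => if u z = 0 then deriv h z / deriv u z else h z / u z, fun z hz => ?_,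
    fun z hz => ?_⟩
  · apply DifferentiableAt.differentiableWithinAt
    have hUz := hU.mem_nhds hz
    have hud := hu.differentiableAt hUz
    have hhd := hh.differentiableAt hUz
    by_cases h0 : u z = 0
    · have du : DifferentiableAt ℂ (dslope u z) z :=
        ((Complex.differentiableOn_dslope hUz).2 hu).differentiableAt hUz
      have dh : DifferentiableAt ℂ (dslope h z) z :=
        ((Complex.differentiableOn_dslope hUz).2 hh).differentiableAt hUz
      have hne : dslope u z z ≠ 0 := by rw [dslope_same]; exact hsimple z hz h0
      refine (dh.div du hne).congr_of_eventuallyEq ?_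
      filter_upwards [du.continuousAt.eventually_ne hne] with y hy
      rcases eq_or_ne y z with rfl | hyz
      · simp [h0]
      · have hsub : y - z ≠ 0 := sub_ne_zero.2 hyz
        rw [dslope_of_ne _ hyz, slope_def_field, h0, sub_zero] at hy
        have huy : u y ≠ 0 := fun h => hy (by simp [h])
        rw [if_neg huy, Pi.div_apply, dslope_of_ne _ hyz, dslope_of_ne _ hyz, slope_def_field,
          slope_def_field, h0, hzero z hz h0, sub_zero, sub_zero]
        field_simp
    · refine (hhd.div hud h0).congr_of_eventuallyEq ?_
      filter_upwards [hud.continuousAt.eventually_ne h0] with y hy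
      rw [if_neg hy, Pi.div_apply]
  · by_cases h0 : u z = 0
    · simp [h0, hzero z hz h0]
    · simp only [h0, if_false]
      field_simp

theorem exists_eq_prod_mul_of_simple_zeros {ι : Type*} {U : Set ℂ} (hU : IsOpen U) (s : Finset ι)
    {u : ι → ℂ → ℂ} {h : ℂ → ℂ} (hu : ∀ i ∈ s, DifferentiableOn ℂ (u i) U)
    (hh : DifferentiableOn ℂ h U)
    (hsimple : ∀ i ∈ s, ∀ z ∈ U, u i z = 0 → deriv (u i) z ≠ 0)
    (hdisj : ∀ i ∈ s, ∀ j ∈ s, i ≠ j → ∀ z ∈ U, u i z = 0 → u j z ≠ 0)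
    (hzero : ∀ i ∈ s, ∀ z ∈ U, u i z = 0 → h z = 0) :
    ∃ g : ℂ → ℂ, DifferentiableOn ℂ g U ∧ ∀ z ∈ U, h z = (∏ i ∈ s, u i z) * g z := by
  classical
  induction s using Finset.induction_on with
  | empty => exact ⟨h, hh, by simp⟩
  | insert i s hi ih =>
    obtain ⟨g, hg, hgh⟩ := ih (fun j hj => hu j (by simp [hj]))
      (fun j hj => hsimple j (by simp [hj]))
      (fun j hj l hl => hdisj j (by simp [hj]) l (by simp [hl]))
      (fun j hj => hzero j (by simp [hj]))
    obtain ⟨g', hg', hgg'⟩ := exists_eq_mul_of_simple_zeros hU (hu i (by simp)) hg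
      (hsimple i (by simp)) fun z hz h0 => by
        have h1 := hzero i (by simp) z hz h0
        rw [hgh z hz] at h1
        refine (mul_eq_zero.1 h1).resolve_left (Finset.prod_ne_zero_iff.2 fun j hj => ?_)
        exact hdisj i (by simp) j (by simp [hj]) (by rintro rfl; exact hi hj) z hz h0
    refine ⟨g', hg', fun z hz => ?_⟩
    rw [hgh z hz, hgg' z hz, Finset.prod_insert hi]
    ring

/-- An even function `g` on `ℂ \ {0}` with `g(pz) = p z² g(z)`, that is, an even theta function
of order `-2`, vanishes: it is bounded on the annulus `‖p‖ ≤ ‖z‖ ≤ 1`, hence everywhere, hence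
constant by Liouville's theorem. -/
theorem eq_zero_of_quasi_neg {p : ℂ} (hp0 : p ≠ 0) (hp : ‖p‖ < 1) {g : ℂ → ℂ}
    (hg : DifferentiableOn ℂ g {0}ᶜ) (hsymm : ∀ z, z ≠ 0 → g z = g z⁻¹)
    (hquasi : ∀ z, z ≠ 0 → g (p * z) = p * z ^ 2 * g z) {z : ℂ} (hz : z ≠ 0) : g z = 0 := by
  have hp' : 0 < ‖p‖ := norm_pos_iff.2 hp0
  have hK : IsCompact (Metric.closedBall (0 : ℂ) 1 \ Metric.ball 0 ‖p‖) :=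
    (isCompact_closedBall _ _).diff Metric.isOpen_ball
  obtain ⟨M, hM⟩ := hK.exists_bound_of_continuousOn (f := g) <| hg.continuousOn.mono <| by
    rintro x ⟨-, hx⟩ (rfl : x = 0)
    simp [hp'] at hx
  have hM0 : 0 ≤ M := (norm_nonneg _).trans (hM 1 (by simp [hp.le]))
  have hstep : ∀ (m : ℕ) (x : ℂ), x ≠ 0 → ‖p‖ ^ (m + 1) ≤ ‖x‖ → ‖x‖ ≤ 1 → ‖g x‖ ≤ M := by
    intro m
    induction m with
    | zero => exact fun x _ h1 h2 => hM x (by simpa [h2] using h1)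
    | succ m ih =>
      intro x hx h1 h2
      by_cases h3 : ‖p‖ ≤ ‖x‖
      · exact hM x (by simp [h2, h3])
      · push Not at h3
        have hy0 : x / p ≠ 0 := div_ne_zero hx hp0
        have hy1 : ‖x / p‖ ≤ 1 := by rw [norm_div, div_le_one hp']; exact h3.le
        have hb := ih (x / p) hy0
          (by rw [norm_div, le_div_iff₀ hp', ← pow_succ]; exact h1) hy1
        have e := hquasi (x / p) hy0
        rw [mul_div_cancel₀ _ hp0] at e
        rw [e, norm_mul, norm_mul, norm_pow]
        have : ‖p‖ * ‖x / p‖ ^ 2 ≤ 1 :=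
          mul_le_one₀ hp.le (by positivity) (pow_le_one₀ (norm_nonneg _) hy1)
        calc _ ≤ 1 * M := by gcongr
          _ = M := one_mul M
  have hsmall : ∀ x : ℂ, x ≠ 0 → ‖x‖ ≤ 1 → ‖g x‖ ≤ M := by
    intro x hx h1
    obtain ⟨m, hm⟩ := exists_pow_lt_of_lt_one (norm_pos_iff.2 hx) hp
    exact hstep m x hx ((pow_le_pow_of_le_one hp'.le hp.le (Nat.le_succ m)).trans hm.le) h1
  have hall : ∀ x : ℂ, x ≠ 0 → ‖g x‖ ≤ M := by
    intro x hx
    rcases le_total ‖x‖ 1 with h1 | h1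
    · exact hsmall x hx h1
    · rw [hsymm x hx]
      exact hsmall _ (inv_ne_zero hx) (by rw [norm_inv]; exact inv_le_one_of_one_le₀ h1)
  -- the singularity at `0` is removable
  have hG := Complex.differentiableOn_update_limUnder_of_bddAbove (f := g) (s := Set.univ)
    (c := 0) univ_mem (by simpa [Set.compl_eq_univ_sdiff] using hg)
    ⟨M, by rintro _ ⟨x, ⟨-, hx⟩, rfl⟩; exact hall x hx⟩
  rw [differentiableOn_univ] at hG
  set G := Function.update g 0 (limUnder (𝓝[≠] 0) g) with hGdef
  have hGg : ∀ x, x ≠ 0 → G x = g x := fun x hx => by rw [hGdef, Function.update_of_ne hx]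
  have hbdd : Bornology.IsBounded (Set.range G) := by
    refine isBounded_iff_forall_norm_le.2 ⟨max M ‖G 0‖, ?_⟩
    rintro _ ⟨x, rfl⟩
    rcases eq_or_ne x 0 with rfl | hx
    · exact le_max_right _ _
    · rw [hGg x hx]; exact (hall x hx).trans (le_max_left _ _)
  have hc : ∀ x y, x ≠ 0 → y ≠ 0 → g x = g y := fun x y hx hy => by
    rw [← hGg x hx, ← hGg y hy]; exact hG.apply_eq_apply_of_bounded hbdd x y
  have h1 := hquasi 1 one_ne_zero
  rw [hc (p * 1) 1 (by simpa) one_ne_zero] at h1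
  have hp1 : p ≠ 1 := by rintro rfl; simp at hp
  rw [hc z 1 hz one_ne_zero]
  have : (1 - p) * g 1 = 0 := by linear_combination h1
  exact (mul_eq_zero.1 this).resolve_left (sub_ne_zero.2 hp1.symm)

/-- An even theta function of order `2n` that vanishes at `n + 1` points in general position
vanishes identically. -/
theorem IsEvenTheta.eq_zero_of_vanish {p : ℂ} (hp0 : p ≠ 0) (hp : ‖p‖ < 1) {ι : Type*}
    {s : Finset ι} {n : ℕ} (hs : s.card = n + 1) {w : ι → ℂ} (hw : ∀ i ∈ s, w i ≠ 0)
    (hself : ∀ i ∈ s, ellTheta (w i * w i) p ≠ 0)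
    (hpair : ∀ i ∈ s, ∀ j ∈ s, i ≠ j → thetaPair p (w i) (w j) ≠ 0)
    {h : ℂ → ℂ} (hh : IsEvenTheta p n h) (hzero : ∀ i ∈ s, h (w i) = 0) {z : ℂ} (hz : z ≠ 0) :
    h z = 0 := by
  have hev : ∀ i ∈ s, IsEvenTheta p 1 (thetaPair p (w i)) := fun i hi =>
    isEvenTheta_thetaPair hp0 hp (hw i hi)
  obtain ⟨g, hg, hgh⟩ := exists_eq_prod_mul_of_simple_zeros isOpen_ne s
    (u := fun i => thetaPair p (w i)) (fun i hi => (hev i hi).holo) hh.holo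
    (fun i hi z hz => deriv_thetaPair_ne_zero hp0 hp (hw i hi) hz (hself i hi))
    (fun i hi j hj hij z hz h0 => thetaPair_ne_zero_of_eq_zero hp0 hp (hw i hi) (hw j hj) hz
      (hpair j hj i hi hij.symm) h0)
    (fun i hi z hz h0 => hh.apply_eq_zero_of_thetaPair hp0 hp (hw i hi) hz (hzero i hi) h0)
  set D : ℂ → ℂ := fun z => ∏ i ∈ s, thetaPair p (w i) z with hD
  have hDe : IsEvenTheta p (n + 1) D := hs ▸ IsEvenTheta.prod hev
  have hDne : ∀ x, x ≠ 0 → ∀ᶠ y in 𝓝[≠] x, y ≠ 0 ∧ D y ≠ 0 := by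
    intro x hx
    refine (eventually_nhdsWithin_of_eventually_nhds (isOpen_ne.mem_nhds hx)).and ?_
    simp only [hD, Finset.prod_ne_zero_iff]
    refine (Finset.eventually_all s).2 fun i hi => ?_
    have hd := (hev i hi).differentiableAt hx
    by_cases h0 : thetaPair p (w i) x = 0
    · exact hd.hasDerivAt.eventually_ne
        (deriv_thetaPair_ne_zero hp0 hp (hw i hi) hx (hself i hi) h0)
    · exact eventually_nhdsWithin_of_eventually_nhds (hd.continuousAt.eventually_ne h0)
  -- identities between continuous functions may be checked away from the zeros of `D`
  have hext : ∀ (A B : ℂ → ℂ), (∀ x, x ≠ 0 → ContinuousAt A x) → (∀ x, x ≠ 0 → ContinuousAt B x) →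
      (∀ x, x ≠ 0 → D x ≠ 0 → A x = B x) → ∀ x, x ≠ 0 → A x = B x := by
    intro A B hA hB hAB x hx
    refine tendsto_nhds_unique_of_eventuallyEq
      ((hA x hx).tendsto.mono_left nhdsWithin_le_nhds)
      ((hB x hx).tendsto.mono_left (nhdsWithin_le_nhds (s := {x}ᶜ))) ?_
    filter_upwards [hDne x hx] with y hy using hAB y hy.1 hy.2
  have hgc : ∀ x, x ≠ 0 → ContinuousAt g x := fun x hx =>
    (hg.differentiableAt (isOpen_ne.mem_nhds hx)).continuousAt
  have hsymm : ∀ x, x ≠ 0 → g x = g x⁻¹ := by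
    refine hext _ _ hgc (fun x hx => ?_) fun x hx hDx => ?_
    · exact (hgc _ (inv_ne_zero hx)).comp (continuousAt_inv₀ hx)
    · have h1 := hh.symm x hx
      rw [one_div, hgh x hx, hgh x⁻¹ (inv_ne_zero hx)] at h1
      have h2 := hDe.symm x hx
      rw [one_div] at h2
      change D x * _ = D x⁻¹ * _ at h1
      rw [← h2] at h1
      exact mul_left_cancel₀ hDx h1
  have hquasi : ∀ x, x ≠ 0 → g (p * x) = p * x ^ 2 * g x := by
    refine hext _ _ (fun x hx => ?_) (fun x hx => ?_) fun x hx hDx => ?_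
    · exact (hgc _ (mul_ne_zero hp0 hx)).comp (f := fun x => p * x) (by fun_prop)
    · exact ContinuousAt.mul (by fun_prop) (hgc x hx)
    · have h1 := hh.quasi x hx
      rw [hgh x hx, hgh (p * x) (mul_ne_zero hp0 hx)] at h1
      change D (p * x) * _ = _ * (D x * _) at h1
      rw [hDe.quasi x hx] at h1
      field_simp at h1
      have hne : p ^ n * x ^ (2 * n) ≠ 0 :=
        mul_ne_zero (pow_ne_zero _ hp0) (pow_ne_zero _ hx)
      refine mul_left_cancel₀ hne ?_
      ring_nf at h1 ⊢
      exact h1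
  rw [hgh z hz, eq_zero_of_quasi_neg hp0 hp hg hsymm hquasi hz, mul_zero]

/-- Lagrange interpolation for even theta functions. -/
theorem IsEvenTheta.eq_sum_interpolation {p : ℂ} (hp0 : p ≠ 0) (hp : ‖p‖ < 1) {ι : Type*}
    [DecidableEq ι] {s : Finset ι} {n : ℕ} (hs : s.card = n + 1) {w : ι → ℂ}
    (hw : ∀ i ∈ s, w i ≠ 0) (hself : ∀ i ∈ s, ellTheta (w i * w i) p ≠ 0)
    (hpair : ∀ i ∈ s, ∀ j ∈ s, i ≠ j → thetaPair p (w i) (w j) ≠ 0)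
    {h : ℂ → ℂ} (hh : IsEvenTheta p n h) {z : ℂ} (hz : z ≠ 0) :
    h z = ∑ i ∈ s, h (w i) *
      ∏ j ∈ s.erase i, (thetaPair p (w j) z / thetaPair p (w j) (w i)) := by
  have hterm : ∀ i ∈ s, IsEvenTheta p n fun z => h (w i) *
      ∏ j ∈ s.erase i, (thetaPair p (w j) z / thetaPair p (w j) (w i)) := by
    intro i hi
    have hc : (s.erase i).card = n := by rw [Finset.card_erase_of_mem hi, hs]; simp
    have := IsEvenTheta.prod (p := p) (s := s.erase i)
      (G := fun j z => (thetaPair p (w j) (w i))⁻¹ * thetaPair p (w j) z) fun j hj =>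
        (isEvenTheta_thetaPair hp0 hp (hw j (Finset.mem_of_mem_erase hj))).const_mul _
    rw [hc] at this
    simpa only [div_eq_inv_mul] using this.const_mul (h (w i))
  have hdiff := hh.add ((IsEvenTheta.sum hterm).const_mul (-1))
  have := hdiff.eq_zero_of_vanish hp0 hp hs hw hself hpair (fun i hi => ?_) hz
  · linear_combination this
  · rw [Finset.sum_eq_single_of_mem i hi]
    · rw [Finset.prod_eq_one]
      · ring
      · intro j hj
        exact div_self (hpair j (Finset.mem_of_mem_erase hj) i hi (Finset.ne_of_mem_erase hj))
    · intro j hj hji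
      rw [Finset.prod_eq_zero (Finset.mem_erase.2 ⟨hji.symm, hi⟩), mul_zero]
      rw [thetaPair_self hp (hw i hi), zero_div]

/-! ### Theta shifted factorials and the Lagrange coefficients -/

section thetaPoch

variable {p q : ℂ}

theorem thetaPoch_one (x : ℂ) : thetaPoch x q p 1 = ellTheta x p := by simp [thetaPoch]

theorem thetaPoch_add (x : ℂ) (m k : ℕ) :
    thetaPoch x q p (m + k) = thetaPoch x q p m * thetaPoch (x * q ^ m) q p k := by
  simp [thetaPoch, Finset.prod_range_add, pow_add, mul_assoc]

theorem thetaPoch_ne_zero_iff (x : ℂ) (n : ℕ) :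
    thetaPoch x q p n ≠ 0 ↔ ∀ j < n, ellTheta (x * q ^ j) p ≠ 0 := by
  simp [thetaPoch, Finset.prod_ne_zero_iff]

theorem thetaPoch_ne_zero_of_le {x : ℂ} {m n : ℕ} (hmn : m ≤ n) (h : thetaPoch x q p n ≠ 0) :
    thetaPoch x q p m ≠ 0 := by
  rw [thetaPoch_ne_zero_iff] at h ⊢
  exact fun j hj => h j (hj.trans_le hmn)

/-- Reversal of a theta shifted factorial, by `θ(1/x;p) = -θ(x;p)/x`. The factors of the two
shifted factorials are at mutually inverse arguments. -/
theorem thetaPoch_reflect (hp0 : p ≠ 0) (hp : ‖p‖ < 1) (hq : q ≠ 0) {x y : ℂ} (hx : x ≠ 0)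
    {k : ℕ} (hxy : x * y * q ^ k = q) :
    thetaPoch y q p k = thetaPoch x q p k * ∏ j ∈ Finset.range k, (-(x * q ^ j)⁻¹) := by
  rw [thetaPoch, thetaPoch, ← Finset.prod_mul_distrib, ← Finset.prod_range_reflect]
  refine Finset.prod_congr rfl fun j hj => ?_
  rw [mul_comm (ellTheta _ p), ← ellTheta_inv hp0 hp (mul_ne_zero hx (pow_ne_zero _ hq))]
  congr 1
  refine eq_inv_of_mul_eq_one_left (mul_right_cancel₀ hq ?_)
  have e : k = k - 1 - j + j + 1 := by have := Finset.mem_range.1 hj; omega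
  have e' : q ^ k = q ^ (k - 1 - j) * q ^ j * q := by rw [← pow_add, ← pow_succ, ← e]
  linear_combination hxy - x * y * e'

/-- The product of two factors of `thetaPoch_reflect` is a power: pairing the index `j` with
`k - 1 - j` makes all terms equal. -/
theorem prod_neg_inv_mul_prod_neg_inv (hq : q ≠ 0) {x y : ℂ} (k : ℕ) :
    (∏ j ∈ Finset.range k, (-(x * q ^ j)⁻¹)) * ∏ j ∈ Finset.range k, (-(y * q ^ j)⁻¹) =
      (q / (x * y * q ^ k)) ^ k := by
  rw [← Finset.prod_range_reflect (fun j => -(y * q ^ j)⁻¹), ← Finset.prod_mul_distrib,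
    Finset.prod_congr rfl (g := fun _ => q / (x * y * q ^ k)), Finset.prod_const,
    Finset.card_range]
  intro j hj
  have e : k = k - 1 - j + j + 1 := by have := Finset.mem_range.1 hj; omega
  have e' : q ^ k = q ^ (k - 1 - j) * q ^ j * q := by rw [← pow_add, ← pow_succ, ← e]
  rw [e']
  simp only [mul_inv, div_eq_mul_inv]
  field_simp

end thetaPoch

theorem prod_range_erase (u : ℕ → ℂ) (k m : ℕ) :
    ∏ j ∈ (Finset.range (k + m + 1)).erase k, u j =
      (∏ j ∈ Finset.range k, u j) * ∏ j ∈ Finset.range m, u (k + 1 + j) := by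
  have e : (Finset.range (k + m + 1)).erase k =
      Finset.range k ∪ (Finset.range m).map (addLeftEmbedding (k + 1)) := by
    ext j
    simp only [Finset.mem_erase, Finset.mem_range, Finset.mem_union, Finset.mem_map,
      addLeftEmbedding_apply]
    constructor
    · rintro ⟨h1, h2⟩
      rcases lt_or_gt_of_ne h1 with h | h
      · exact Or.inl h
      · exact Or.inr ⟨j - (k + 1), by omega, by omega⟩
    · rintro (h | ⟨i, hi, rfl⟩) <;> omega
  rw [e, Finset.prod_union, Finset.prod_map]
  · rfl
  · rw [Finset.disjoint_left]
    simp only [Finset.mem_range, Finset.mem_map, addLeftEmbedding_apply]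
    rintro j hj ⟨i, -, rfl⟩
    omega

theorem prod_erase_thetaPair (p q a z : ℂ) (k m : ℕ) :
    ∏ j ∈ (Finset.range (k + m + 1)).erase k, thetaPair p (a * q ^ j) z =
      thetaPoch (a * z) q p k * thetaPoch (a * q * z * q ^ k) q p m *
        (thetaPoch (a / z) q p k * thetaPoch (a * q / z * q ^ k) q p m) := by
  rw [prod_range_erase]
  simp only [thetaPair, thetaPoch, Finset.prod_mul_distrib]
  rw [mul_mul_mul_comm]
  have e3 (j : ℕ) : a * q ^ (k + 1 + j) * z = a * q * z * q ^ k * q ^ j := by ring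
  have e4 (j : ℕ) : a * q ^ (k + 1 + j) / z = a * q / z * q ^ k * q ^ j := by ring
  simp only [e3, e4, mul_right_comm a (q ^ _) z, mul_div_right_comm a (q ^ _) z]

/-- The Lagrange denominator at the node `a q^k` in terms of theta shifted factorials. -/
theorem prod_erase_thetaPair_node {p q a : ℂ} (hq : q ≠ 0) (ha : a ≠ 0) (k m : ℕ) :
    ∏ j ∈ (Finset.range (k + m + 1)).erase k, thetaPair p (a * q ^ j) (a * q ^ k) =
      thetaPoch (a ^ 2 * q ^ k) q p k * thetaPoch (a ^ 2 * q ^ (2 * k + 1)) q p m *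
        (thetaPoch (q ^ k)⁻¹ q p k * thetaPoch q q p m) := by
  rw [prod_erase_thetaPair]
  have e1 : a * (a * q ^ k) = a ^ 2 * q ^ k := by ring
  have e2 : a * q * (a * q ^ k) * q ^ k = a ^ 2 * q ^ (2 * k + 1) := by ring
  have e3 : a / (a * q ^ k) = (q ^ k)⁻¹ := by field_simp
  have e4 : a * q / (a * q ^ k) * q ^ k = q := by field_simp
  rw [e1, e2, e3, e4]

/-- The coefficients of the Lagrange interpolation formula with nodes `a q^k`, as they appear in
the expansion formula. -/
theorem interpolation_coeff {p q c a z : ℂ} {k m : ℕ} (hp0 : p ≠ 0) (hp : ‖p‖ < 1) (hq : q ≠ 0)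
    (hc : c ≠ 0) (ha : a ≠ 0)
    (hac : thetaPoch (a * c) q p (k + m) ≠ 0) (hca : thetaPoch (c / a) q p (k + m) ≠ 0)
    (hqq : thetaPoch q q p (k + m) ≠ 0)
    (hcw : thetaPoch (c * (a * q ^ k)) q p (k + m) ≠ 0)
    (hcw' : thetaPoch (c / (a * q ^ k)) q p (k + m) ≠ 0)
    (hgen : thetaPoch (a ^ 2) q p (k + m + 1 + k) ≠ 0)
    (hz1 : thetaPoch (a * q * z) q p (k + m) ≠ 0) (hz2 : thetaPoch (a * q / z) q p (k + m) ≠ 0) :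
    thetaPochs [a ^ 2 * q, q] q p (k + m) /
        thetaPochs [a * c, c / a, a * q * z, a * q / z] q p (k + m) *
        ∏ j ∈ (Finset.range (k + m + 1)).erase k,
          (thetaPair p (a * q ^ j) z / thetaPair p (a * q ^ j) (a * q ^ k)) =
      q ^ k * (ellTheta (a ^ 2 * q ^ (2 * k)) p / ellTheta (a ^ 2) p) *
          (thetaPochs [q ^ (-((k + m : ℕ) : ℤ)), a ^ 2, a * q / c, a * c * q ^ (k + m), a * z,
              a / z] q p k /
            thetaPochs [q, a ^ 2 * q ^ (k + m + 1), a * c, a * q ^ (1 - ((k + m : ℕ) : ℤ)) / c,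
              a * q * z, a * q / z] q p k) /
          thetaPochs [c * (a * q ^ k), c / (a * q ^ k)] q p (k + m) := by
  have hqk : ∀ i : ℕ, q ^ i ≠ 0 := fun i => pow_ne_zero _ hq
  rw [Finset.prod_div_distrib, prod_erase_thetaPair, prod_erase_thetaPair_node hq ha]
  simp only [thetaPochs, List.map_cons, List.map_nil, List.prod_cons, List.prod_nil, mul_one]
  -- the factors involving `z`
  have z1 := thetaPoch_add (p := p) (q := q) (a * q * z) k m
  have z2 := thetaPoch_add (p := p) (q := q) (a * q / z) k m
  rw [z1] at hz1
  rw [z2] at hz2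
  -- the factors involving `a ^ 2`
  have s1 : thetaPoch (a ^ 2) q p (k + m + 1 + k) = thetaPoch (a ^ 2) q p k *
      (thetaPoch (a ^ 2 * q ^ k) q p k * (ellTheta (a ^ 2 * q ^ (2 * k)) p *
        thetaPoch (a ^ 2 * q ^ (2 * k + 1)) q p m)) := by
    rw [show k + m + 1 + k = k + (k + (1 + m)) by ring, thetaPoch_add, thetaPoch_add,
      thetaPoch_add, thetaPoch_one]
    ring_nf
  have s2 : thetaPoch (a ^ 2) q p (k + m + 1 + k) = ellTheta (a ^ 2) p *
      thetaPoch (a ^ 2 * q) q p (k + m) * thetaPoch (a ^ 2 * q ^ (k + m + 1)) q p k := by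
    rw [thetaPoch_add, add_comm (k + m) 1, thetaPoch_add _ 1, thetaPoch_one, pow_one]
  have s3 := s1.symm.trans s2
  have hg1 := hgen
  rw [s1] at hg1
  rw [s2] at hgen
  -- the factors without `a`, `c`, `z`
  have q1 : thetaPoch q q p (k + m) = thetaPoch q q p m * thetaPoch (q * q ^ m) q p k := by
    rw [add_comm, thetaPoch_add]
  have q2 := thetaPoch_reflect hp0 hp hq (x := q * q ^ m) (y := q ^ (-((k + m : ℕ) : ℤ)))
    (k := k) (mul_ne_zero hq (hqk m)) (by
      rw [zpow_neg, zpow_natCast, pow_add]; have := hqk k; have := hqk m; field_simp)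
  have q3 := thetaPoch_reflect hp0 hp hq (x := q) (y := (q ^ k)⁻¹) (k := k) hq
    (by have := hqk k; field_simp)
  have q4 := prod_neg_inv_mul_prod_neg_inv hq (x := q * q ^ m) (y := q) k
  have hqk' : thetaPoch q q p k ≠ 0 := thetaPoch_ne_zero_of_le (by omega) hqq
  rw [q1] at hqq
  -- the factors involving `c`
  have c1 : thetaPoch (a * c) q p (k + m) * thetaPoch (a * c * q ^ (k + m)) q p k =
      thetaPoch (a * c) q p k * thetaPoch (c * (a * q ^ k)) q p (k + m) := by
    rw [← thetaPoch_add, add_comm (k + m) k, thetaPoch_add,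
      show a * c * q ^ k = c * (a * q ^ k) by ring]
  have c2 : thetaPoch (c / (a * q ^ k)) q p (k + m) * thetaPoch (c * q ^ m / a) q p k =
      thetaPoch (c / (a * q ^ k)) q p k * thetaPoch (c / a) q p (k + m) := by
    have e1 : c * q ^ m / a = c / (a * q ^ k) * q ^ (k + m) := by
      rw [pow_add]; have := hqk k; field_simp
    have e2 : c / a = c / (a * q ^ k) * q ^ k := by have := hqk k; field_simp
    rw [e1, ← thetaPoch_add, e2, ← thetaPoch_add, add_comm (k + m) k]
  have c3 := thetaPoch_reflect hp0 hp hq (x := a * q / c) (y := c / (a * q ^ k)) (k := k)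
    (div_ne_zero (mul_ne_zero ha hq) hc) (by have := hqk k; field_simp)
  have c4 := thetaPoch_reflect hp0 hp hq (x := c * q ^ m / a)
    (y := a * q ^ (1 - ((k + m : ℕ) : ℤ)) / c) (k := k)
    (div_ne_zero (mul_ne_zero hc (hqk m)) ha) (by
      rw [zpow_sub₀ hq, zpow_natCast, zpow_one, pow_add]
      have := hqk k; have := hqk m; field_simp)
  have c5 := prod_neg_inv_mul_prod_neg_inv hq (x := a * q / c) (y := c * q ^ m / a) k
  have c6 : thetaPoch (c * q ^ m / a) q p k ≠ 0 := by
    rw [add_comm, thetaPoch_add] at hca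
    rw [mul_div_right_comm]
    exact right_ne_zero_of_mul hca
  have hack : thetaPoch (a * c) q p k ≠ 0 := thetaPoch_ne_zero_of_le (by omega) hac
  have hP : ∀ x : ℂ, x ≠ 0 → ∏ j ∈ Finset.range k, (-(x * q ^ j)⁻¹) ≠ 0 := fun x hx =>
    Finset.prod_ne_zero_iff.2 fun j _ => neg_ne_zero.2 (inv_ne_zero (mul_ne_zero hx (hqk j)))
  have hP1 := hP q hq
  have hP2 := hP (c * q ^ m / a) (div_ne_zero (mul_ne_zero hc (hqk m)) ha)
  have e4 : (q / (q * q ^ m * q * q ^ k)) ^ k = ((q ^ k) * (q ^ (k + m)) ^ k)⁻¹ := by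
    rw [← mul_pow, ← inv_pow, pow_add]; congr 1; have := hqk k; have := hqk m; field_simp
  have e5 : (q / (a * q / c * (c * q ^ m / a) * q ^ k)) ^ k = ((q ^ (k + m)) ^ k)⁻¹ := by
    rw [← inv_pow, pow_add]; congr 1; have := hqk k; have := hqk m; field_simp
  rw [e4] at q4
  rw [e5] at c5
  have hN : (q ^ (k + m)) ^ k ≠ 0 := pow_ne_zero _ (hqk _)
  have hK : q ^ k ≠ 0 := hqk k
  rw [z1, z2, q1, q3]
  rw [c3] at c2
  -- the identity is now one of rational functions in the shifted factorials, and it splits into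
  -- the parts `ra`, `rq`, `rc` below; `N = q ^ ((k + m) * k)` cancels between the last two
  generalize (q ^ (k + m)) ^ k = N at *
  generalize thetaPoch (a * c) q p (k + m) = acn at *
  generalize thetaPoch (c / a) q p (k + m) = can at *
  generalize thetaPoch (c * (a * q ^ k)) q p (k + m) = W at *
  generalize thetaPoch (c / (a * q ^ k)) q p (k + m) = W' at *
  generalize thetaPoch (c * q ^ m / a) q p k = E at *
  generalize thetaPoch (a * q ^ (1 - ((k + m : ℕ) : ℤ)) / c) q p k = G at *
  generalize thetaPoch (a * q / c) q p k = F at *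
  generalize thetaPoch (a * c * q ^ (k + m)) q p k = H at *
  generalize thetaPoch (a * c) q p k = ack at *
  generalize thetaPoch (q ^ (-((k + m : ℕ) : ℤ))) q p k = Y at *
  generalize thetaPoch (q * q ^ m) q p k = X at *
  generalize thetaPoch q q p k = Qk at *
  generalize thetaPoch q q p m = Qm at *
  generalize ∏ j ∈ Finset.range k, (-(q * q ^ j)⁻¹) = P1 at *
  generalize ∏ j ∈ Finset.range k, (-(q * q ^ m * q ^ j)⁻¹) = P2 at *
  generalize ∏ j ∈ Finset.range k, (-(a * q / c * q ^ j)⁻¹) = P3 at *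
  generalize ∏ j ∈ Finset.range k, (-(c * q ^ m / a * q ^ j)⁻¹) = P4 at *
  generalize thetaPoch (a ^ 2 * q) q p (k + m) = Aq at *
  generalize thetaPoch (a ^ 2) q p k = A0 at *
  generalize thetaPoch (a ^ 2 * q ^ k) q p k = A1 at *
  generalize thetaPoch (a ^ 2 * q ^ (k + m + 1)) q p k = A2 at *
  generalize thetaPoch (a ^ 2 * q ^ (2 * k + 1)) q p m = A3 at *
  generalize ellTheta (a ^ 2 * q ^ (2 * k)) p = t1 at *
  generalize ellTheta (a ^ 2) p = t0 at *
  generalize thetaPoch (a * z) q p k = u1 at *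
  generalize thetaPoch (a / z) q p k = u2 at *
  generalize thetaPoch (a * q * z) q p k = u3 at *
  generalize thetaPoch (a * q / z) q p k = u4 at *
  generalize thetaPoch (a * q * z * q ^ k) q p m = u5 at *
  generalize thetaPoch (a * q / z * q ^ k) q p m = u6 at *
  generalize q ^ k = K at *
  simp only [mul_ne_zero_iff] at hz1 hz2 hg1 hgen hqq
  obtain ⟨hz1, hz1'⟩ := hz1
  obtain ⟨hz2, hz2'⟩ := hz2
  obtain ⟨hg0, hg1, hg2, hg3⟩ := hg1
  obtain ⟨⟨hg4, hg5⟩, hg6⟩ := hgen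
  obtain ⟨hQm, hX⟩ := hqq
  have hG : G ≠ 0 := by rw [c4]; exact mul_ne_zero c6 hP2
  have ra : Aq / (A1 * A3) = t1 / t0 * (A0 / A2) := by
    field_simp
    linear_combination -s3
  have rq : X / (Qk * P1) = K * N * (Y / Qk) := by
    have : P2 * P1 * (K * N) = 1 := by rw [q4]; field_simp
    rw [q2]
    field_simp
    linear_combination -this
  have rc : 1 / (acn * can) = F * H / (ack * G) / (W * W') / N := by
    have h1 : P3 * P4 * N = 1 := by rw [c5]; field_simp
    have h2 : W' * G * N = F * can := by
      rw [c4]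
      linear_combination P4 * N * c2 + F * can * h1
    field_simp
    linear_combination ack * W * h2 - F * can * c1
  calc _ = u1 * u2 / (u3 * u4) * (Aq / (A1 * A3)) * (X / (Qk * P1)) * (1 / (acn * can)) := by
        field_simp
    _ = _ := by
        rw [ra, rq, rc]
        field_simp

/-! ### Interpolation in `W_c^n` and passage to special nodes -/

theorem thetaPochs_pair_eq_prod (p q c z : ℂ) (n : ℕ) :
    thetaPochs [c * z, c / z] q p n = ∏ j ∈ Finset.range n, thetaPair p (c * q ^ j) z := by
  simp only [thetaPochs, List.map_cons, List.map_nil, List.prod_cons, List.prod_nil, mul_one,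
    thetaPoch, thetaPair, ← Finset.prod_mul_distrib, mul_right_comm c (q ^ _) z,
    mul_div_right_comm c (q ^ _) z]

/-- Over the common denominator `(cz, c/z;q,p)_n` the members of `W_c^n` have even theta
functions of order `2n` as numerators. -/
theorem exists_evenTheta_of_mem_ellW {p q c : ℂ} {n : ℕ} (hp0 : p ≠ 0) (hp : ‖p‖ < 1) (hq : q ≠ 0)
    (hc : c ≠ 0) {f : ℂ → ℂ} (hf : f ∈ ellW c q p n) :
    ∃ h, IsEvenTheta p n h ∧ ∀ z, z ≠ 0 → thetaPochs [c * z, c / z] q p n ≠ 0 →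
      f z = h z / thetaPochs [c * z, c / z] q p n := by
  induction hf using Submodule.span_induction with
  | mem f hf =>
    obtain ⟨k, hk, g, hg, rfl⟩ := hf
    obtain ⟨m, rfl⟩ := Nat.exists_eq_add_of_le hk
    have hprod := IsEvenTheta.prod (p := p) (s := Finset.range m)
      (G := fun j => thetaPair p (c * q ^ (k + j))) fun j _ =>
        isEvenTheta_thetaPair hp0 hp (mul_ne_zero hc (pow_ne_zero _ hq))
    rw [Finset.card_range] at hprod
    refine ⟨_, hg.mul hprod, fun z hz hne => ?_⟩
    rw [thetaPochs_pair_eq_prod, Finset.prod_range_add] at hne ⊢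
    simp only [thetaPochs_pair_eq_prod]
    rw [mul_div_mul_right _ _ (right_ne_zero_of_mul hne)]
  | zero => exact ⟨fun _ => 0, .zero, by simp⟩
  | add f₁ f₂ _ _ h₁ h₂ =>
    obtain ⟨g₁, hg₁, e₁⟩ := h₁
    obtain ⟨g₂, hg₂, e₂⟩ := h₂
    refine ⟨_, hg₁.add hg₂, fun z hz hne => ?_⟩
    rw [Pi.add_apply, e₁ z hz hne, e₂ z hz hne, add_div]
  | smul r f _ h =>
    obtain ⟨g, hg, e⟩ := h
    refine ⟨_, hg.const_mul r, fun z hz hne => ?_⟩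
    rw [Pi.smul_apply, smul_eq_mul, e z hz hne, mul_div_assoc]

/-- The expansion formula for `f = h / (cz, c/z;q,p)_n` when the nodes `a q^k` are in general
position. -/
theorem expansion_of_generic {p q c a z : ℂ} {n : ℕ} {h : ℂ → ℂ}
    (hp0 : p ≠ 0) (hp : ‖p‖ < 1) (hq : q ≠ 0) (hc : c ≠ 0) (ha : a ≠ 0) (hz : z ≠ 0)
    (hh : IsEvenTheta p n h)
    (hac : thetaPoch (a * c) q p n ≠ 0) (hca : thetaPoch (c / a) q p n ≠ 0)
    (hqq : thetaPoch q q p n ≠ 0)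
    (hpole : ∀ k ≤ n, thetaPochs [c * (a * q ^ k), c / (a * q ^ k)] q p n ≠ 0)
    (hgen : thetaPoch (a ^ 2) q p (2 * n + 1) ≠ 0)
    (hzpole : thetaPochs [c * z, c / z] q p n ≠ 0)
    (hz1 : thetaPoch (a * q * z) q p n ≠ 0) (hz2 : thetaPoch (a * q / z) q p n ≠ 0) :
    thetaPochs [a ^ 2 * q, q, c * z, c / z] q p n /
        thetaPochs [a * c, c / a, a * q * z, a * q / z] q p n *
        (h z / thetaPochs [c * z, c / z] q p n) =
      ∑ k ∈ Finset.range (n + 1),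
        q ^ k * (ellTheta (a ^ 2 * q ^ (2 * k)) p / ellTheta (a ^ 2) p) *
          (thetaPochs [q ^ (-(n : ℤ)), a ^ 2, a * q / c, a * c * q ^ n, a * z, a / z] q p k /
            thetaPochs [q, a ^ 2 * q ^ (n + 1), a * c, a * q ^ (1 - (n : ℤ)) / c,
              a * q * z, a * q / z] q p k) *
          (h (a * q ^ k) / thetaPochs [c * (a * q ^ k), c / (a * q ^ k)] q p n) := by
  have hqk : ∀ i : ℕ, q ^ i ≠ 0 := fun i => pow_ne_zero _ hq
  have hgen' := (thetaPoch_ne_zero_iff _ _).1 hgen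
  have hqq' := (thetaPoch_ne_zero_iff _ _).1 hqq
  have hlt : ∀ i j : ℕ, j < i → i ≤ n → ellTheta (a * q ^ i / (a * q ^ j)) p ≠ 0 := by
    intro i j hji hi
    convert hqq' (i - j - 1) (by omega) using 2
    rw [mul_div_mul_left _ _ ha, div_eq_iff (hqk j), ← pow_succ', ← pow_add]
    congr 1
    omega
  have key := hh.eq_sum_interpolation hp0 hp (s := Finset.range (n + 1)) (by simp)
    (w := fun k => a * q ^ k) (fun k _ => mul_ne_zero ha (hqk k))
    (fun k hk => by
      convert hgen' (k + k) (by have := Finset.mem_range.1 hk; omega) using 2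
      ring)
    (fun i hi j hj hij => by
      have hi' := Finset.mem_range.1 hi
      have hj' := Finset.mem_range.1 hj
      refine mul_ne_zero ?_ ?_
      · convert hgen' (i + j) (by omega) using 2
        ring
      · rcases lt_or_gt_of_ne hij with hlt' | hlt'
        · have h1 := hlt j i hlt' (by omega)
          rw [← inv_div, ellTheta_inv hp0 hp (div_ne_zero (mul_ne_zero ha (hqk _))
            (mul_ne_zero ha (hqk _)))]
          exact mul_ne_zero (neg_ne_zero.2 (inv_ne_zero (div_ne_zero (mul_ne_zero ha (hqk _))
            (mul_ne_zero ha (hqk _))))) h1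
        · exact hlt i j hlt' (by omega)) hz
  have hL : thetaPochs [a ^ 2 * q, q, c * z, c / z] q p n /
        thetaPochs [a * c, c / a, a * q * z, a * q / z] q p n *
        (h z / thetaPochs [c * z, c / z] q p n) =
      thetaPochs [a ^ 2 * q, q] q p n /
        thetaPochs [a * c, c / a, a * q * z, a * q / z] q p n * h z := by
    have : thetaPochs [a ^ 2 * q, q, c * z, c / z] q p n =
        thetaPochs [a ^ 2 * q, q] q p n * thetaPochs [c * z, c / z] q p n := by
      simp [thetaPochs, mul_assoc]
    rw [this]
    field_simp
  rw [hL, key, Finset.mul_sum]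
  refine Finset.sum_congr rfl fun k hk => ?_
  obtain ⟨m, rfl⟩ := Nat.exists_eq_add_of_le (Nat.lt_succ_iff.1 (Finset.mem_range.1 hk))
  have hpk := hpole k (by omega)
  have hpk' := hpk
  simp only [thetaPochs, List.map_cons, List.map_nil, List.prod_cons, List.prod_nil, mul_one,
    mul_ne_zero_iff] at hpk'
  have := interpolation_coeff hp0 hp hq hc ha hac hca hqq hpk'.1 hpk'.2
    (thetaPoch_ne_zero_of_le (by omega) hgen) hz1 hz2
  rw [mul_left_comm, this]
  ring

theorem ContinuousAt.ellTheta {p x : ℂ} {u : ℂ → ℂ} (hp : ‖p‖ < 1) (hu : ContinuousAt u x)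
    (h0 : u x ≠ 0) : ContinuousAt (fun y => _root_.ellTheta (u y) p) x :=
  (differentiableAt_ellTheta hp h0).continuousAt.comp (f := u) hu

theorem ContinuousAt.thetaPoch {p q x : ℂ} {u : ℂ → ℂ} (hp : ‖p‖ < 1) (hq : q ≠ 0)
    (hu : ContinuousAt u x) (h0 : u x ≠ 0) (k : ℕ) :
    ContinuousAt (fun y => _root_.thetaPoch (u y) q p k) x :=
  tendsto_finsetProd _ fun j _ => (hu.mul continuousAt_const).ellTheta hp
    (mul_ne_zero h0 (pow_ne_zero j hq))

/-- The zeros of `a ↦ (a²;q,p)_n` are isolated. -/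
theorem eventually_thetaPoch_sq_ne_zero {p q a : ℂ} (hp0 : p ≠ 0) (hp : ‖p‖ < 1) (hq : q ≠ 0)
    (ha : a ≠ 0) (n : ℕ) : ∀ᶠ x in 𝓝[≠] a, thetaPoch (x ^ 2) q p n ≠ 0 := by
  simp only [thetaPoch, Finset.prod_ne_zero_iff]
  refine (Finset.eventually_all _).2 fun j _ => ?_
  have hne : a ^ 2 * q ^ j ≠ 0 := mul_ne_zero (pow_ne_zero _ ha) (pow_ne_zero _ hq)
  have hin : HasDerivAt (fun x : ℂ => x ^ 2 * q ^ j) (2 * a * q ^ j) a := by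
    simpa using ((hasDerivAt_id a).pow 2).mul_const (q ^ j)
  have hd := (differentiableAt_ellTheta hp hne).hasDerivAt.comp a hin
  by_cases h0 : ellTheta (a ^ 2 * q ^ j) p = 0
  · exact hd.eventually_ne (mul_ne_zero (deriv_ellTheta_ne_zero hp0 hp hne h0)
      (mul_ne_zero (mul_ne_zero two_ne_zero ha) (pow_ne_zero _ hq)))
  · exact eventually_nhdsWithin_of_eventually_nhds (hd.continuousAt.eventually_ne h0)

theorem theorem2p4 (p q c a : ℂ) (n : ℕ)
    (hp0 : p ≠ 0) (hp1 : ‖p‖ < 1) (hq : q ≠ 0) (hc : c ≠ 0) (ha : a ≠ 0)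
    -- the denominators of the formula which do not involve `z` do not vanish
    (hden0 : ellTheta (a ^ 2) p ≠ 0)
    (hden1 : thetaPochs [a * c, c / a, q, a ^ 2 * q ^ (n + 1)] q p n ≠ 0)
    -- the interpolation points `a q^k` are not poles of the members of `W_c^n`
    (hpole : ∀ k ≤ n, thetaPochs [c * (a * q ^ k), c / (a * q ^ k)] q p n ≠ 0)
    (f : ℂ → ℂ) (hf : f ∈ ellW c q p n)
    (z : ℂ) (hz : z ≠ 0)
    -- `z` is neither a pole of the members of `W_c^n` nor a zero of a denominator of the formula
    (hzpole : thetaPochs [c * z, c / z] q p n ≠ 0)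
    (hzden : thetaPochs [a * q * z, a * q / z] q p n ≠ 0) :
    thetaPochs [a ^ 2 * q, q, c * z, c / z] q p n /
        thetaPochs [a * c, c / a, a * q * z, a * q / z] q p n * f z =
      ∑ k ∈ Finset.range (n + 1),
        q ^ k * (ellTheta (a ^ 2 * q ^ (2 * k)) p / ellTheta (a ^ 2) p) *
          (thetaPochs [q ^ (-(n : ℤ)), a ^ 2, a * q / c, a * c * q ^ n, a * z, a / z] q p k /
            thetaPochs [q, a ^ 2 * q ^ (n + 1), a * c, a * q ^ (1 - (n : ℤ)) / c,
              a * q * z, a * q / z] q p k) *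
          f (a * q ^ k) := by
  have hqk : ∀ i : ℕ, q ^ i ≠ 0 := fun i => pow_ne_zero _ hq
  obtain ⟨h, hh, hfh⟩ := exists_evenTheta_of_mem_ellW hp0 hp1 hq hc hf
  rw [hfh z hz hzpole, Finset.sum_congr rfl fun k hk => by
    rw [hfh (a * q ^ k) (mul_ne_zero ha (hqk k))
      (hpole k (Nat.lt_succ_iff.1 (Finset.mem_range.1 hk)))]]
  simp only [thetaPochs, List.map_cons, List.map_nil, List.prod_cons, List.prod_nil, mul_one,
    mul_ne_zero_iff] at hden1 hzden
  obtain ⟨hac, hca, hqq, ha2⟩ := hden1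
  obtain ⟨hz1, hz2⟩ := hzden
  -- the denominator factor `(aq^(1-n)/c;q,p)_n` is a multiple of `(c/a;q,p)_n`
  have hacn : thetaPoch (a * q ^ (1 - (n : ℤ)) / c) q p n ≠ 0 := by
    have hca0 : c / a ≠ 0 := div_ne_zero hc ha
    rw [thetaPoch_reflect hp0 hp1 hq (x := c / a) hca0]
    · exact mul_ne_zero hca (Finset.prod_ne_zero_iff.2 fun j _ =>
        neg_ne_zero.2 (inv_ne_zero (mul_ne_zero hca0 (hqk j))))
    · rw [zpow_sub₀ hq, zpow_natCast, zpow_one]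
      have := hqk n
      field_simp
  have hid : ContinuousAt (fun b : ℂ => b) a := continuousAt_id
  -- continuity in `a` of all the theta shifted factorials in the formula
  have C : ∀ {u : ℂ → ℂ} (k : ℕ), ContinuousAt u a → u a ≠ 0 →
      ContinuousAt (fun b => thetaPoch (u b) q p k) a := fun k hu h0 => hu.thetaPoch hp1 hq h0 k
  have c1 (k : ℕ) : ContinuousAt (fun b => thetaPoch (b * c) q p k) a :=
    C k (by fun_prop) (mul_ne_zero ha hc)
  have c2 (k : ℕ) : ContinuousAt (fun b => thetaPoch (c / b) q p k) a :=
    C k (by fun_prop (disch := exact ha)) (div_ne_zero hc ha)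
  have c3 (k : ℕ) : ContinuousAt (fun b => thetaPoch (b * q * z) q p k) a :=
    C k (by fun_prop) (mul_ne_zero (mul_ne_zero ha hq) hz)
  have c4 (k : ℕ) : ContinuousAt (fun b => thetaPoch (b * q / z) q p k) a :=
    C k (by fun_prop) (div_ne_zero (mul_ne_zero ha hq) hz)
  have c5 (k m : ℕ) : ContinuousAt (fun b => thetaPoch (c * (b * q ^ k)) q p m) a :=
    C m (by fun_prop) (mul_ne_zero hc (mul_ne_zero ha (hqk k)))
  have c6 (k m : ℕ) : ContinuousAt (fun b => thetaPoch (c / (b * q ^ k)) q p m) a :=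
    C m (by fun_prop (disch := exact mul_ne_zero ha (hqk k)))
      (div_ne_zero hc (mul_ne_zero ha (hqk k)))
  have c7 (k : ℕ) : ContinuousAt (fun b => thetaPoch (b ^ 2 * q) q p k) a :=
    C k (by fun_prop) (mul_ne_zero (pow_ne_zero _ ha) hq)
  have c8 (k : ℕ) : ContinuousAt (fun b => thetaPoch (b ^ 2) q p k) a :=
    C k (by fun_prop) (pow_ne_zero _ ha)
  have c9 (k : ℕ) : ContinuousAt (fun b => thetaPoch (b * q / c) q p k) a :=
    C k (by fun_prop) (div_ne_zero (mul_ne_zero ha hq) hc)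
  have c10 (k m : ℕ) : ContinuousAt (fun b => thetaPoch (b * c * q ^ m) q p k) a :=
    C k (by fun_prop) (mul_ne_zero (mul_ne_zero ha hc) (hqk m))
  have c11 (k : ℕ) : ContinuousAt (fun b => thetaPoch (b * z) q p k) a :=
    C k (by fun_prop) (mul_ne_zero ha hz)
  have c12 (k : ℕ) : ContinuousAt (fun b => thetaPoch (b / z) q p k) a :=
    C k (by fun_prop) (div_ne_zero ha hz)
  have c13 (k m : ℕ) : ContinuousAt (fun b => thetaPoch (b ^ 2 * q ^ m) q p k) a :=
    C k (by fun_prop) (mul_ne_zero (pow_ne_zero _ ha) (hqk m))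
  have c14 (k : ℕ) : ContinuousAt (fun b => thetaPoch (b * q ^ (1 - (n : ℤ)) / c) q p k) a :=
    C k (by fun_prop) (div_ne_zero (mul_ne_zero ha (zpow_ne_zero _ hq)) hc)
  have c15 (m : ℕ) : ContinuousAt (fun b => ellTheta (b ^ 2 * q ^ m) p) a :=
    ContinuousAt.ellTheta hp1 (by fun_prop) (mul_ne_zero (pow_ne_zero _ ha) (hqk m))
  have c16 : ContinuousAt (fun b => ellTheta (b ^ 2) p) a :=
    ContinuousAt.ellTheta hp1 (by fun_prop) (pow_ne_zero _ ha)
  have c17 (k : ℕ) : ContinuousAt (fun b => h (b * q ^ k)) a :=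
    (hh.differentiableAt (mul_ne_zero ha (hqk k))).continuousAt.comp (f := fun b => b * q ^ k)
      (by fun_prop)
  have c18 (k m : ℕ) :
      ContinuousAt (fun b => thetaPochs [c * (b * q ^ k), c / (b * q ^ k)] q p m) a := by
    simp only [thetaPochs, List.map_cons, List.map_nil, List.prod_cons, List.prod_nil, mul_one]
    exact (c5 k m).mul (c6 k m)
  -- both sides are continuous in `a`, and they agree for generic `b` close to `a`
  refine tendsto_nhds_unique_of_eventuallyEq (l := 𝓝[≠] a)
    (f := fun a => thetaPochs [a ^ 2 * q, q, c * z, c / z] q p n /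
        thetaPochs [a * c, c / a, a * q * z, a * q / z] q p n *
        (h z / thetaPochs [c * z, c / z] q p n))
    (g := fun a => ∑ k ∈ Finset.range (n + 1),
        q ^ k * (ellTheta (a ^ 2 * q ^ (2 * k)) p / ellTheta (a ^ 2) p) *
          (thetaPochs [q ^ (-(n : ℤ)), a ^ 2, a * q / c, a * c * q ^ n, a * z, a / z] q p k /
            thetaPochs [q, a ^ 2 * q ^ (n + 1), a * c, a * q ^ (1 - (n : ℤ)) / c,
              a * q * z, a * q / z] q p k) *
          (h (a * q ^ k) / thetaPochs [c * (a * q ^ k), c / (a * q ^ k)] q p n)) ?_ ?_ ?_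
  · refine ContinuousAt.tendsto ?_ |>.mono_left nhdsWithin_le_nhds
    simp only [thetaPochs, List.map_cons, List.map_nil, List.prod_cons, List.prod_nil, mul_one]
    refine ContinuousAt.mul (ContinuousAt.div ?_ ?_ ?_) continuousAt_const
    · exact (c7 n).mul continuousAt_const
    · exact (c1 n).mul ((c2 n).mul ((c3 n).mul (c4 n)))
    · exact mul_ne_zero hac (mul_ne_zero hca (mul_ne_zero hz1 hz2))
  · refine tendsto_finsetSum _ fun k hk => ?_
    have hkn : k ≤ n := Nat.lt_succ_iff.1 (Finset.mem_range.1 hk)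
    refine ContinuousAt.tendsto ?_ |>.mono_left nhdsWithin_le_nhds
    refine ContinuousAt.mul (ContinuousAt.mul (continuousAt_const.mul ((c15 _).div c16 hden0)) ?_)
      ((c17 k).div (c18 k n) (hpole k hkn))
    simp only [thetaPochs, List.map_cons, List.map_nil, List.prod_cons, List.prod_nil, mul_one]
    refine ContinuousAt.div ?_ ?_ ?_
    · exact continuousAt_const.mul ((c8 k).mul ((c9 k).mul ((c10 k n).mul ((c11 k).mul (c12 k)))))
    · exact continuousAt_const.mul ((c13 k _).mul ((c1 k).mul ((c14 k).mul ((c3 k).mul (c4 k)))))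
    · have le := fun {x : ℂ} => thetaPoch_ne_zero_of_le (p := p) (q := q) (x := x) hkn
      exact mul_ne_zero (le hqq) (mul_ne_zero (le ha2) (mul_ne_zero (le hac) (mul_ne_zero
        (le hacn) (mul_ne_zero (le hz1) (le hz2)))))
  · filter_upwards [eventually_thetaPoch_sq_ne_zero hp0 hp1 hq ha (2 * n + 1),
      eventually_nhdsWithin_of_eventually_nhds (hid.eventually_ne ha),
      eventually_nhdsWithin_of_eventually_nhds ((c1 n).eventually_ne hac),
      eventually_nhdsWithin_of_eventually_nhds ((c2 n).eventually_ne hca),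
      eventually_nhdsWithin_of_eventually_nhds ((c3 n).eventually_ne hz1),
      eventually_nhdsWithin_of_eventually_nhds ((c4 n).eventually_ne hz2),
      eventually_nhdsWithin_of_eventually_nhds ((Finset.eventually_all (Finset.range (n + 1))).2
        fun k hk => (c18 k n).eventually_ne
          (hpole k (Nat.lt_succ_iff.1 (Finset.mem_range.1 hk))))]
      with b hgen hb h1 h2 h3 h4 h5
    exact expansion_of_generic hp0 hp1 hq hc hb hz hh h1 h2 hqq
      (fun k hk => h5 k (Finset.mem_range.2 (Nat.lt_succ_iff.2 hk))) hgen hzpole h3 h4
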